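/- Let $k$ be an algebraically closed field of characteristic zero and let $\mathcal G$ be a finite 2-group, i.e. a (small) monoidal category in which every morphism is an isomorphism, every object is invertible, and both the set $\pi_1(\mathcal G)$ of isomorphism classes of objects and the group $\pi_2(\mathcal G)=\mathrm{End}(\mathbf 1)$ are finite. Let $2\mathrm{Vect}$ be the 2-category of finite semisimple $k$-linear categories, $k$-linear functors and natural transformations, let $2\mathrm{Rep}(\mathcal G)=\mathrm{Fun}(\mathrm B\mathcal G,2\mathrm{Vect})$ be the 2-category of finite semisimple 2-representations of $\mathcal G$ (pseudofunctors, pseudonatural transformations and modifications, where $\mathrm B\mathcal G$ is the one-object delooping of $\mathcal G$), and let $\omega\colon 2\mathrm{Rep}(\mathcal G)\to 2\mathrm{Vect}$ be the forgetful 2-functor. Let $\mathrm{Vect}$ be the category of finite-dimensional $k$-vector spaces. Then the functor category $\mathrm{Fun}(\mathcal G,\mathrm{Vect})$ is finite semisimple, so that with the left $\mathcal G$-action by right translation, $(g\odot F)(x)=F(x\otimes g)$, it is an object $\mathcal F_r(\mathcal G)$ of $2\mathrm{Rep}(\mathcal G)$ (the regular 2-representation); $\omega$ has a right adjoint $\omega^R$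 (in the bicategorical sense); and for every right adjoint $\omega^R$ of $\omega$ there is an equivalence $$\mathcal F_r(\mathcal G)\simeq\omega^R(\mathrm{Vect})\quad\text{in } 2\mathrm{Rep}(\mathcal G).$$ Moreover, for every $\mathcal V\in 2\mathrm{Rep}(\mathcal G)$, composing with the evaluation $\mathrm{Fun}(\mathcal G,\mathrm{Vect})\to\mathrm{Vect}$, $F\mapsto F(\mathbf 1)$, gives an equivalence of categories $$2\mathrm{Rep}(\mathcal G)(\mathcal V,\mathcal F_r(\mathcal G))\simeq 2\mathrm{Vect}(\omega(\mathcal V),\mathrm{Vect}).$$ -/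

import Mathlib

open CategoryTheory CategoryTheory.Limits
open scoped CategoryTheory.Pseudofunctor.StrongTrans

universe u

namespace TwoRepTheory

/-! ### Finite 2-groups -/

section TwoGroup

open MonoidalCategory

/-- A 2-group: a monoidal category in which every morphism is an isomorphism and every object is
invertible. It is finite when the set `π₁` of isomorphism classes of objects and the group
`π₂ = End(𝟙)` are finite. -/
class IsFiniteTwoGroup (G : Type u) [Category.{u} G] [MonoidalCategory G] : Prop where
  isIso {x y : G} (f : x ⟶ y) : IsIso f
  invertible (x : G) : ∃ y : G, Nonempty (x ⊗ y ≅ 𝟙_ G) ∧ Nonempty (y ⊗ x ≅ 𝟙_ G)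
  finite_pi_one : Finite (Quotient (isIsomorphicSetoid G))
  finite_pi_two : Finite (𝟙_ G ⟶ 𝟙_ G)

/-- The one-point delooping `BG`: a bicategory with one object, whose 1-morphisms are the objects
of `G`. The composite of `f` followed by `g` is `g ⊗ f`, so that pseudofunctors out of `BG` are
*left* `G`-actions. (In Mathlib's `MonoidalSingleObj` this composite is `f ⊗ g`.) -/
structure Delooping (G : Type u) where
  pt ::

instance (G : Type u) [Category.{u} G] [MonoidalCategory G] : Bicategory (Delooping G) where
  Hom _ _ := G
  id _ := 𝟙_ G
  comp f g := g ⊗ f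
  homCategory _ _ := inferInstanceAs (Category G)
  whiskerLeft f _ _ η := η ▷ f
  whiskerRight η h := h ◁ η
  associator f g h := (α_ h g f).symm
  leftUnitor f := ρ_ f
  rightUnitor f := λ_ f
  whisker_exchange η θ := (MonoidalCategory.whisker_exchange θ η).symm
  pentagon _ _ _ _ := MonoidalCategory.pentagon_inv

end TwoGroup

/-! ### Finite semisimple categories and the 2-category `2Vect` -/

/-- A finite semisimple `k`-linear category: an abelian `k`-linear category (the fields
`hasFiniteProducts` to `normalEpi`) with finite-dimensional hom spaces and finitely many
isomorphism classes of simple objects, in which every object is a finite direct sum of simple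
objects. -/
class IsFiniteSemisimple (k : Type u) [Field k] (C : Type (u + 1)) [Category.{u} C]
    [Preadditive C] [Linear k C] : Prop where
  hasFiniteProducts : HasFiniteProducts C
  hasKernels : HasKernels C
  hasCokernels : HasCokernels C
  normalMono : IsNormalMonoCategory C
  normalEpi : IsNormalEpiCategory C
  finite_hom (x y : C) : Module.Finite k (x ⟶ y)
  finite_simples : ∃ (n : ℕ) (s : Fin n → C), ∀ x : C, Simple x → ∃ i, Nonempty (x ≅ s i)
  semisimple (x : C) : ∃ (n : ℕ) (s : Fin n → C), (∀ i, Simple (s i)) ∧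
    ∃ b : Bicone s, Nonempty b.IsBilimit ∧ Nonempty (x ≅ b.pt)

variable (k : Type u) [Field k]

/-- Objects of `2Vect`: finite semisimple `k`-linear categories. -/
structure TwoVect where
  carrier : Type (u + 1)
  [category : Category.{u} carrier]
  [preadditive : Preadditive carrier]
  [linear : Linear k carrier]
  [finiteSemisimple : IsFiniteSemisimple k carrier]

attribute [instance] TwoVect.category TwoVect.preadditive TwoVect.linear TwoVect.finiteSemisimple

variable {k}

namespace TwoVect

/-- 1-morphisms of `2Vect`: `k`-linear functors. -/
structure Hom (C D : TwoVect k) where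
  functor : C.carrier ⥤ D.carrier
  [additive : functor.Additive]
  [linear : functor.Linear k]

attribute [instance] Hom.additive Hom.linear

instance : CategoryStruct (TwoVect k) where
  Hom C D := Hom C D
  id C := { functor := 𝟭 C.carrier }
  comp F G := { functor := F.functor ⋙ G.functor }

/-- 2-morphisms of `2Vect`: natural transformations. -/
@[ext]
structure Hom₂ {C D : TwoVect k} (F G : C ⟶ D) where
  nat : Hom.functor F ⟶ Hom.functor G

instance (C D : TwoVect k) : Category (C ⟶ D) where
  Hom F G := Hom₂ F G
  id F := { nat := 𝟙 (Hom.functor F) }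
  comp η θ := { nat := η.nat ≫ θ.nat }

@[ext]
lemma hom₂_ext {C D : TwoVect k} {F G : C ⟶ D} {η θ : F ⟶ G}
    (h : ∀ x, (Hom₂.nat η).app x = (Hom₂.nat θ).app x) : η = θ :=
  Hom₂.ext (NatTrans.ext (funext h))

@[simp] lemma id_functor (C : TwoVect k) : Hom.functor (𝟙 C) = 𝟭 C.carrier := rfl

@[simp] lemma comp_functor {C D E : TwoVect k} (F : C ⟶ D) (G : D ⟶ E) :
    Hom.functor (F ≫ G) = Hom.functor F ⋙ Hom.functor G := rfl

@[simp] lemma id_nat {C D : TwoVect k} (F : C ⟶ D) :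
    Hom₂.nat (𝟙 F) = 𝟙 (Hom.functor F) := rfl

@[simp] lemma comp_nat {C D : TwoVect k} {F G H : C ⟶ D} (η : F ⟶ G) (θ : G ⟶ H) :
    Hom₂.nat (η ≫ θ) = Hom₂.nat η ≫ Hom₂.nat θ := rfl

/-- A natural isomorphism of functors gives a 2-isomorphism. -/
@[simps]
def mkIso {C D : TwoVect k} {F G : C ⟶ D} (e : Hom.functor F ≅ Hom.functor G) : F ≅ G where
  hom := { nat := e.hom }
  inv := { nat := e.inv }
  hom_inv_id := by ext x; simp
  inv_hom_id := by ext x; simp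

/-- The 2-category of finite semisimple categories, linear functors and natural
transformations. -/
instance : Bicategory (TwoVect k) where
  homCategory C D := inferInstance
  whiskerLeft F _ _ η := Hom₂.mk (Functor.whiskerLeft (Hom.functor F) (Hom₂.nat η))
  whiskerRight η G := Hom₂.mk (Functor.whiskerRight (Hom₂.nat η) (Hom.functor G))
  associator F G H :=
    mkIso (Functor.associator (Hom.functor F) (Hom.functor G) (Hom.functor H))
  leftUnitor F := mkIso (Functor.leftUnitor (Hom.functor F))
  rightUnitor F := mkIso (Functor.rightUnitor (Hom.functor F))

section

open Bicategory

variable {C D E E' : TwoVect k}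

@[simp] lemma whiskerLeft_nat_app (F : C ⟶ D) {G H : D ⟶ E} (η : G ⟶ H) (x : C.carrier) :
    (Hom₂.nat (F ◁ η)).app x = (Hom₂.nat η).app ((Hom.functor F).obj x) := rfl

@[simp] lemma whiskerRight_nat_app {F G : C ⟶ D} (η : F ⟶ G) (H : D ⟶ E) (x : C.carrier) :
    (Hom₂.nat (η ▷ H)).app x = (Hom.functor H).map ((Hom₂.nat η).app x) := rfl

@[simp] lemma associator_hom_nat_app (F : C ⟶ D) (G : D ⟶ E) (H : E ⟶ E') (x : C.carrier) :
    (Hom₂.nat (α_ F G H).hom).app x = 𝟙 _ := rfl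

@[simp] lemma associator_inv_nat_app (F : C ⟶ D) (G : D ⟶ E) (H : E ⟶ E') (x : C.carrier) :
    (Hom₂.nat (α_ F G H).inv).app x = 𝟙 _ := rfl

@[simp] lemma leftUnitor_hom_nat_app (F : C ⟶ D) (x : C.carrier) :
    (Hom₂.nat (λ_ F).hom).app x = 𝟙 _ := rfl

@[simp] lemma leftUnitor_inv_nat_app (F : C ⟶ D) (x : C.carrier) :
    (Hom₂.nat (λ_ F).inv).app x = 𝟙 _ := rfl

@[simp] lemma rightUnitor_hom_nat_app (F : C ⟶ D) (x : C.carrier) :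
    (Hom₂.nat (ρ_ F).hom).app x = 𝟙 _ := rfl

@[simp] lemma rightUnitor_inv_nat_app (F : C ⟶ D) (x : C.carrier) :
    (Hom₂.nat (ρ_ F).inv).app x = 𝟙 _ := rfl

end

end TwoVect

/-! ### Right adjoints of 2-functors -/

section Biadjoint

open Bicategory

universe w₁ v₁ u₁ w₂ v₂ u₂

variable {B : Type u₁} [Bicategory.{w₁, v₁} B] {C : Type u₂} [Bicategory.{w₂, v₂} C]

/-- For a 2-functor `F` and a 1-morphism `e : F x ⟶ c`, the functor
`B(b, x) ⥤ C(F b, c)`, `f ↦ F f ≫ e`, which is pseudonatural in `b`. -/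
def transpose (F : Pseudofunctor B C) {x : B} {c : C} (e : F.obj x ⟶ c) (b : B) :
    (b ⟶ x) ⥤ (F.obj b ⟶ c) :=
  F.mapFunctor b x ⋙ postcomp (F.obj b) e

/-- A right adjoint of a 2-functor `F`, in the bicategorical sense: a 2-functor `right` and a
pseudonatural transformation `counit : F ∘ right ⟶ id` such that the functors
`B(b, right c) ⥤ C(F b, c)`, `f ↦ F f ≫ counit c`, are equivalences of categories. -/
structure RightAdjointOf (F : Pseudofunctor B C) where
  right : Pseudofunctor C B
  counit : right.comp F ⟶ Pseudofunctor.id C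
  isEquivalence (b : B) (c : C) :
    (transpose F (x := right.obj c) (c := c) (counit.app c) b).IsEquivalence

end Biadjoint

/-! ### 2-representations -/

section TwoRep

open MonoidalCategory

variable (k) (G : Type u) [Category.{u} G] [MonoidalCategory G]

/-- The 2-category `2Rep(G)` of finite semisimple 2-representations: pseudofunctors
`BG ⥤ 2Vect`, strong transformations and modifications. -/
abbrev TwoRep := Pseudofunctor (Delooping G) (TwoVect k)

/-- The forgetful 2-functor `ω : 2Rep(G) ⥤ 2Vect`, evaluation at the unique object of `BG`. -/
def forgetful : Pseudofunctor (TwoRep k G) (TwoVect k) where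
  obj V := V.obj .pt
  map φ := φ.app .pt
  map₂ Γ := Γ.as.app .pt
  mapId V := Iso.refl (𝟙 (V.obj .pt))
  mapComp φ ψ := Iso.refl (φ.app .pt ≫ ψ.app .pt)
  map₂_left_unitor φ := by
    change (Bicategory.leftUnitor (φ.app Delooping.pt)).hom =
      𝟙 (𝟙 _ ≫ φ.app Delooping.pt) ≫ Bicategory.whiskerRight (𝟙 (𝟙 _)) (φ.app Delooping.pt) ≫
        (Bicategory.leftUnitor (φ.app Delooping.pt)).hom
    simp

/-! ### The regular 2-representation -/

lemma mono_of_injective_fgModuleCat {x y : FGModuleCat.{u} k} (f : x ⟶ y)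
    (hf : Function.Injective f.hom.hom) : Mono f := by
  constructor
  intro z g h e
  ext v
  have e' : (g ≫ f).hom.hom v = (h ≫ f).hom.hom v := by rw [e]
  exact hf e'

lemma simple_fgModuleCat_self : Simple (FGModuleCat.of k k) where
  mono_isIso_iff_nonzero {y} f hf := by
    constructor
    · intro _ h0
      have h1 : 𝟙 (FGModuleCat.of k k) = 0 := by
        rw [← IsIso.inv_hom_id f]
        simp [h0]
      exact one_ne_zero (α := k) (congrArg (fun g => g.hom.hom (1 : k)) h1)
    · intro h0
      have hinj : Function.Injective f.hom.hom := by
        rw [← LinearMap.ker_eq_bot, LinearMap.ker_eq_bot']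
        intro v hv
        have e : FGModuleCat.ofHom (LinearMap.toSpanSingleton k y v) ≫ f = 0 ≫ f := by
          ext
          change f.hom.hom ((1 : k) • v) = f.hom.hom 0
          rw [one_smul, hv, map_zero]
        have e' := (cancel_mono f).1 e
        have e'' : (FGModuleCat.ofHom (LinearMap.toSpanSingleton k y v)).hom.hom (1 : k) = 0 := by
          rw [e']
          rfl
        exact (one_smul k v).symm.trans e''
      have hsurj : Function.Surjective f.hom.hom :=
        LinearMap.surjective (f := (f.hom.hom : y →ₗ[k] k))
          (fun h => h0 (FGModuleCat.hom_ext h))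
      exact (LinearEquiv.ofBijective (f.hom.hom : y →ₗ[k] k) ⟨hinj, hsurj⟩).toFGModuleCatIso.isIso_hom

instance : IsFiniteSemisimple k (FGModuleCat.{u} k) where
  hasFiniteProducts := inferInstance
  hasKernels := inferInstance
  hasCokernels := inferInstance
  normalMono := inferInstance
  normalEpi := inferInstance
  finite_hom _ _ := inferInstance
  finite_simples := by
    refine ⟨1, fun _ => FGModuleCat.of k k, fun x hx => ⟨0, ?_⟩⟩
    have hne : ∃ v : x, v ≠ 0 := by
      by_contra! h
      apply id_nonzero x
      ext v
      exact h v
    obtain ⟨v, hv⟩ := hne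
    let f : FGModuleCat.of k k ⟶ x := FGModuleCat.ofHom (LinearMap.toSpanSingleton k x v)
    have : Mono f := mono_of_injective_fgModuleCat k f (smul_left_injective k hv)
    have hf : f ≠ 0 := by
      intro h
      have e : f.hom.hom (1 : k) = 0 := by
        rw [h]
        rfl
      exact hv ((one_smul k v).symm.trans e)
    have := isIso_of_mono_of_nonzero hf
    exact ⟨(asIso f).symm⟩
  semisimple x := by
    let B := Module.finBasis k x
    refine ⟨Module.finrank k x, fun _ => FGModuleCat.of k k,
      fun _ => simple_fgModuleCat_self k, ⟨x, fun i => FGModuleCat.ofHom (B.coord i),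
      fun i => FGModuleCat.ofHom (LinearMap.toSpanSingleton k x (B i)), ?_⟩, ⟨?_⟩, ⟨Iso.refl x⟩⟩
    · intro i j
      split_ifs with h
      · subst h
        ext
        change B.coord i ((1 : k) • B i) = 1
        simp
      · ext
        change B.coord j ((1 : k) • B i) = 0
        simp [h]
    · apply isBilimitOfTotal
      have hsum : ∀ v : x, (∑ i, B.coord i v • B i) = v := B.sum_repr
      let F : (x ⟶ x) →+ (x →ₗ[k] x) :=
        { toFun := fun g => g.hom.hom, map_zero' := rfl, map_add' := fun _ _ => rfl }
      apply FGModuleCat.hom_ext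
      change F _ = LinearMap.id
      rw [map_sum]
      refine LinearMap.ext fun v => ?_
      rw [LinearMap.sum_apply]
      exact hsum v

/-- `Vect` as an object of `2Vect`. -/
def vect : TwoVect k where
  carrier := FGModuleCat.{u} k

/-- The right translation `(g ⊙ F)(x) = F(x ⊗ g)` on `Fun(G, Vect)`, as a functor of `F`. -/
@[simps! obj_obj obj_map map_app]
def rightTranslation (g : G) : (G ⥤ FGModuleCat.{u} k) ⥤ (G ⥤ FGModuleCat.{u} k) :=
  (Functor.whiskeringLeft G G (FGModuleCat.{u} k)).obj (tensorRight g)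

instance (g : G) : (rightTranslation k G g).Additive where

instance (g : G) : (rightTranslation k G g).Linear k where

/-- A morphism `a : g ⟶ g'` acts by `F(x ⊗ a) : F(x ⊗ g) ⟶ F(x ⊗ g')`. -/
@[simps! app_app]
def rightTranslationMap {g g' : G} (a : g ⟶ g') :
    rightTranslation k G g ⟶ rightTranslation k G g' :=
  (Functor.whiskeringLeft G G (FGModuleCat.{u} k)).map ((curriedTensor G).flip.map a)

/-- The isomorphism `F(x ⊗ 𝟙) ≅ F(x)`. -/
@[simps! hom_app_app inv_app_app]
def rightTranslationUnit : rightTranslation k G (𝟙_ G) ≅ 𝟭 (G ⥤ FGModuleCat.{u} k) :=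
  (Functor.whiskeringLeft G G (FGModuleCat.{u} k)).mapIso (rightUnitorNatIso G)

/-- The isomorphism `F(x ⊗ (g ⊗ f)) ≅ F((x ⊗ g) ⊗ f)`, that is,
`(g ⊗ f) ⊙ F ≅ g ⊙ (f ⊙ F)`. -/
@[simps! hom_app_app inv_app_app]
def rightTranslationTensor (g f : G) :
    rightTranslation k G (g ⊗ f) ≅ rightTranslation k G f ⋙ rightTranslation k G g :=
  (Functor.whiskeringLeft G G (FGModuleCat.{u} k)).mapIso (tensorRightTensor g f)

/-- The regular 2-representation `F_r(G)`: the category `Fun(G, Vect)` with the left `G`-action by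
right translation, where `h` is the fact that this category is finite semisimple. -/
def regular (h : IsFiniteSemisimple k (G ⥤ FGModuleCat.{u} k)) : TwoRep k G where
  obj _ := { carrier := G ⥤ FGModuleCat.{u} k, finiteSemisimple := h }
  map g := TwoVect.Hom.mk (rightTranslation k G g)
  map₂ a := TwoVect.Hom₂.mk (rightTranslationMap k G a)
  mapId _ := TwoVect.mkIso (rightTranslationUnit k G)
  mapComp f g := TwoVect.mkIso (rightTranslationTensor k G g f)
  map₂_id f := TwoVect.hom₂_ext fun F => NatTrans.ext (funext fun x => by
    change F.map (x ◁ 𝟙 (f : G)) = 𝟙 (F.obj (x ⊗ (f : G)))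
    simp)
  map₂_comp {_ _ f g g'} η θ := TwoVect.hom₂_ext fun F => NatTrans.ext (funext fun x => by
    change F.map (x ◁ ((η : (f : G) ⟶ g) ≫ (θ : (g : G) ⟶ g'))) =
      F.map (x ◁ (η : (f : G) ⟶ g)) ≫ F.map (x ◁ (θ : (g : G) ⟶ g'))
    simp)
  map₂_whisker_left f g g' η := TwoVect.hom₂_ext fun F => NatTrans.ext (funext fun x => by
    change F.map (x ◁ ((η : (g : G) ⟶ g') ▷ (f : G))) =
      F.map (α_ x g f).inv ≫ F.map ((x ◁ (η : (g : G) ⟶ g')) ▷ (f : G)) ≫ F.map (α_ x g' f).hom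
    simp only [← F.map_comp]
    congr 1
    simp)
  map₂_whisker_right {_ _ _ f f'} η g := TwoVect.hom₂_ext fun F =>
    NatTrans.ext (funext fun x => by
      change F.map (x ◁ ((g : G) ◁ (η : (f : G) ⟶ f'))) =
        F.map (α_ x g f).inv ≫ F.map ((x ⊗ (g : G)) ◁ (η : (f : G) ⟶ f')) ≫
          F.map (α_ x g f').hom
      simp only [← F.map_comp]
      congr 1
      simp)
  map₂_associator f g h := TwoVect.hom₂_ext fun F => NatTrans.ext (funext fun x => by
    change F.map (x ◁ (α_ (h : G) g f).inv) =
      F.map (α_ x h ((g : G) ⊗ (f : G))).inv ≫ F.map (α_ (x ⊗ (h : G)) g f).inv ≫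
        𝟙 (F.obj (((x ⊗ (h : G)) ⊗ (g : G)) ⊗ (f : G))) ≫
        F.map ((α_ x (h : G) g).hom ▷ (f : G)) ≫ F.map (α_ x ((h : G) ⊗ (g : G)) f).hom
    rw [Category.id_comp]
    simp only [← F.map_comp]
    congr 1
    monoidal_coherence)
  map₂_left_unitor f := TwoVect.hom₂_ext fun F => NatTrans.ext (funext fun x => by
    change F.map (x ◁ (ρ_ (f : G)).hom) =
      F.map (α_ x (f : G) (𝟙_ G)).inv ≫ F.map (ρ_ (x ⊗ (f : G))).hom ≫
        𝟙 (F.obj (x ⊗ (f : G)))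
    rw [Category.comp_id, ← F.map_comp]
    congr 1
    monoidal_coherence)
  map₂_right_unitor f := TwoVect.hom₂_ext fun F => NatTrans.ext (funext fun x => by
    change F.map (x ◁ (λ_ (f : G)).hom) =
      F.map (α_ x (𝟙_ G) (f : G)).inv ≫ F.map ((ρ_ x).hom ▷ (f : G)) ≫
        𝟙 (F.obj (x ⊗ (f : G)))
    rw [Category.comp_id, ← F.map_comp]
    congr 1
    monoidal_coherence)

/-- Evaluation at the tensor unit, `Fun(G, Vect) ⥤ Vect`, as a 1-morphism
`ω(F_r(G)) ⟶ Vect` of `2Vect`. -/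
def evalUnit (h : IsFiniteSemisimple k (G ⥤ FGModuleCat.{u} k)) :
    (forgetful k G).obj (regular k G h) ⟶ vect k :=
  TwoVect.Hom.mk ((evaluation G (FGModuleCat.{u} k)).obj (𝟙_ G))
    (additive := { }) (linear := { })

end TwoRep

end TwoRepTheory

/-! The category of functors `G ⥤ C` is the cofree 2-representation on `C`, by a categorified
Frobenius reciprocity. An equivariant `φ : V ⟶ Fun(G, C)` satisfies `φ a x ≅ φ a (𝟙 ⊗ x) ≅ φ (x · a)
𝟙`, so it is determined by the linear functor `L a = φ a 𝟙`; conversely any linear `L` yields `a ↦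
(x ↦ L (x · a))`. The same formula governs 2-morphisms, so transposing along evaluation at `𝟙` is an
equivalence (`isEquivalence_transpose_evalOne`). With `C = Vect` this is the last claim. As `C`
varies it makes `C ↦ Fun(G, C)` a right adjoint of the forgetful 2-functor (`cofreeRightAdjoint`).
For an arbitrary right adjoint `R`, both `Fun(G, Vect)` and `R(Vect)` represent `V ↦ 2Vect(ω V,
Vect)`, hence are equivalent by a Yoneda argument (`nonempty_equivalence_of_transpose`). All this
needs `Fun(G, C)` to lie in `2Vect` (`isFiniteSemisimple_functor`). Invertibility of objects makes
`G` a groupoid with finite hom sets, and Maschke averaging over these, possible in characteristic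
zero, splits every monomorphism. Splitting and finite-dimensional endomorphism spaces give
decompositions into simples, and every simple functor is a summand of one of finitely many free
functors. -/

namespace TwoRepTheory

/-! ### Semisimplicity versus splitting of monomorphisms. -/

section Semisimple

universe v w

variable {C : Type w} [Category.{v} C]

/-- The object `x` is a finite direct sum of simple objects. -/
def IsSumOfSimples [HasZeroMorphisms C] (x : C) : Prop :=
  ∃ (n : ℕ) (s : Fin n → C), (∀ i, Simple (s i)) ∧
    ∃ b : Bicone s, Nonempty b.IsBilimit ∧ Nonempty (x ≅ b.pt)

lemma IsSumOfSimples.of_finite [HasZeroMorphisms C] {ι : Type} [Finite ι] {s : ι → C}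
    (hs : ∀ i, Simple (s i)) (b : Bicone s) (hb : b.IsBilimit) {x : C} (e : x ≅ b.pt) :
    IsSumOfSimples x := by
  obtain ⟨n, ⟨f⟩⟩ := Finite.exists_equiv_fin ι
  exact ⟨n, s ∘ f.symm, fun i => hs _, b.whisker f.symm,
    ⟨(Bicone.whiskerIsBilimitIff b f.symm).symm hb⟩, ⟨e⟩⟩

lemma IsSumOfSimples.of_isZero [Preadditive C] {x : C} (hx : IsZero x) : IsSumOfSimples x :=
  .of_finite (ι := Empty) (s := fun i => i.elim) (fun i => i.elim)
    { pt := x, π := fun i => i.elim, ι := fun i => i.elim, ι_π := fun i => i.elim }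
    (isBilimitOfTotal _ (hx.eq_of_src _ _)) (Iso.refl x)

lemma IsSumOfSimples.of_simple [Preadditive C] {x : C} (hx : Simple x) : IsSumOfSimples x :=
  .of_finite (ι := Unit) (s := fun _ => x) (fun _ => hx)
    { pt := x, π := fun _ => 𝟙 x, ι := fun _ => 𝟙 x, ι_π := by simp }
    (isBilimitOfTotal _ (by simp)) (Iso.refl x)

lemma IsSumOfSimples.of_binaryBicone [Preadditive C] {y z : C} (b : BinaryBicone y z)
    (hb : b.IsBilimit) (hy : IsSumOfSimples y) (hz : IsSumOfSimples z) :
    IsSumOfSimples b.pt := by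
  obtain ⟨n, s, hs, c, ⟨hc⟩, ⟨e⟩⟩ := hy
  obtain ⟨m, t, ht, d, ⟨hd⟩, ⟨f⟩⟩ := hz
  have htot : b.fst ≫ b.inl + b.snd ≫ b.inr = 𝟙 b.pt := IsBilimit.binary_total hb
  have hctot := IsBilimit.total hc
  have hdtot := IsBilimit.total hd
  refine .of_finite (ι := Fin n ⊕ Fin m) (s := Sum.elim s t) (by rintro (i | i); exacts [hs i, ht i])
    { pt := b.pt
      π := Sum.rec (fun i => b.fst ≫ e.hom ≫ c.π i) (fun i => b.snd ≫ f.hom ≫ d.π i)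
      ι := Sum.rec (fun i => c.ι i ≫ e.inv ≫ b.inl) (fun i => d.ι i ≫ f.inv ≫ b.inr)
      ι_π := ?_ } (isBilimitOfTotal _ ?_) (Iso.refl _)
  · rintro (i | i) (j | j)
    · by_cases h : i = j
      · subst h; simp; rfl
      · simp [c.ι_π, h]; rfl
    · simp; rfl
    · simp; rfl
    · by_cases h : i = j
      · subst h; simp; rfl
      · simp [d.ι_π, h]; rfl
  · rw [Fintype.sum_sum_type]
    have h1 : ∑ i, (b.fst ≫ e.hom ≫ c.π i) ≫ c.ι i ≫ e.inv ≫ b.inl = b.fst ≫ b.inl := by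
      have : ∀ i, (b.fst ≫ e.hom ≫ c.π i) ≫ c.ι i ≫ e.inv ≫ b.inl =
        (b.fst ≫ e.hom) ≫ (c.π i ≫ c.ι i) ≫ e.inv ≫ b.inl := by simp
      simp_rw [this, ← Preadditive.comp_sum, ← Preadditive.sum_comp, hctot]
      simp
    have h2 : ∑ i, (b.snd ≫ f.hom ≫ d.π i) ≫ d.ι i ≫ f.inv ≫ b.inr = b.snd ≫ b.inr := by
      have : ∀ i, (b.snd ≫ f.hom ≫ d.π i) ≫ d.ι i ≫ f.inv ≫ b.inr =
        (b.snd ≫ f.hom) ≫ (d.π i ≫ d.ι i) ≫ f.inv ≫ b.inr := by simp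
      simp_rw [this, ← Preadditive.comp_sum, ← Preadditive.sum_comp, hdtot]
      simp
    exact (congrArg₂ (· + ·) h1 h2).trans htot

lemma exists_ι_comp_ne_zero [Preadditive C] {x y : C} (f : x ⟶ y)
    (hf : f ≠ 0) {n : ℕ} (s : Fin n → C) (b : Bicone s) (hb : b.IsBilimit) (e : x ≅ b.pt) :
    ∃ i, b.ι i ≫ e.inv ≫ f ≠ 0 := by
  by_contra! hcon
  apply hf
  rw [← cancel_epi e.inv, ← Category.id_comp (e.inv ≫ f), ← IsBilimit.total hb,
    Preadditive.sum_comp, comp_zero]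
  exact Finset.sum_eq_zero fun i _ => by rw [Category.assoc, hcon, comp_zero]

variable (k : Type u) [Field k]

/-- Block-diagonal endomorphisms embed in all endomorphisms. This makes the dimension of `End` a
decreasing measure for splitting off summands. -/
lemma finrank_end_add_le [Preadditive C] [Linear k C] {y z : C} (b : BinaryBicone y z)
    [Module.Finite k (b.pt ⟶ b.pt)] [Module.Finite k (y ⟶ y)] [Module.Finite k (z ⟶ z)] :
    Module.finrank k (y ⟶ y) + Module.finrank k (z ⟶ z) ≤ Module.finrank k (b.pt ⟶ b.pt) := by
  rw [← Module.finrank_prod]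
  let T : ((y ⟶ y) × (z ⟶ z)) →ₗ[k] (b.pt ⟶ b.pt) :=
    { toFun := fun p => b.fst ≫ p.1 ≫ b.inl + b.snd ≫ p.2 ≫ b.inr
      map_add' := fun p q => by simp; abel
      map_smul' := fun r p => by simp }
  refine LinearMap.finrank_le_finrank_of_injective (f := T) ?_
  rintro ⟨p, q⟩ ⟨p', q'⟩ h
  have h' : b.fst ≫ p ≫ b.inl + b.snd ≫ q ≫ b.inr = b.fst ≫ p' ≫ b.inl + b.snd ≫ q' ≫ b.inr := h
  refine Prod.ext ?_ ?_
  · simpa using b.inl ≫= h' =≫ b.fst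
  · simpa using b.inr ≫= h' =≫ b.snd

/-- Induction on `dim End(x)`. If `x` is neither zero nor simple, it has a proper nonzero subobject,
which splits off with its cokernel as complement. Both pieces have nonzero endomorphism spaces, so
by `finrank_end_add_le` each has a strictly smaller one than `x`. -/
lemma isSumOfSimples_of_isSplitMono [Abelian C] [Linear k C]
    (hfin : ∀ x y : C, Module.Finite k (x ⟶ y))
    (hsplit : ∀ {x y : C} (f : x ⟶ y), Mono f → IsSplitMono f) (x : C) : IsSumOfSimples x := by
  induction h : Module.finrank k (x ⟶ x) using Nat.strong_induction_on generalizing x with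
  | _ n ih =>
  subst h
  by_cases hx : IsZero x
  · exact .of_isZero hx
  by_cases hs : Simple x
  · exact .of_simple hs
  have hpos : ∀ z : C, ¬ IsZero z → 0 < Module.finrank k (z ⟶ z) := fun z hz => by
    have := hfin z z
    have : Nontrivial (z ⟶ z) := ⟨𝟙 z, 0, fun h => hz ((IsZero.iff_id_eq_zero z).2 h)⟩
    exact Module.finrank_pos
  obtain ⟨y, f, hf, h0, hiso⟩ : ∃ (y : C) (f : y ⟶ x), Mono f ∧ f ≠ 0 ∧ ¬ IsIso f := by
    by_contra! hcon
    refine hs ⟨fun f hf => ⟨fun _ h => hx ?_, fun h => hcon _ f hf h⟩⟩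
    rw [IsZero.iff_id_eq_zero, ← cancel_epi f, h, zero_comp, zero_comp]
  have := hsplit f hf
  let b := binaryBiconeOfIsSplitMonoOfCokernel (cokernelIsCokernel f)
  have hb : b.IsBilimit := isBilimitBinaryBiconeOfIsSplitMonoOfCokernel (cokernelIsCokernel f)
  have hy : ¬ IsZero y := fun h => h0 (h.eq_of_src _ _)
  have hz : ¬ IsZero (cokernel f) := fun h => hiso (by
    have : Epi f := Preadditive.epi_of_cokernel_zero (h.eq_of_tgt _ _)
    exact isIso_of_mono_of_epi f)
  have h1 := hpos _ hy
  have h2 := hpos _ hz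
  have i1 := hfin y y
  have i2 := hfin (cokernel f) (cokernel f)
  have i3 : Module.Finite k (b.pt ⟶ b.pt) := hfin x x
  have hle := finrank_end_add_le k b
  have hle' : Module.finrank k (y ⟶ y) + Module.finrank k (cokernel f ⟶ cokernel f) ≤
    Module.finrank k (x ⟶ x) := hle
  exact IsSumOfSimples.of_binaryBicone b hb (ih _ (show _ < Module.finrank k (x ⟶ x) by omega) y rfl)
    (ih _ (show Module.finrank k (cokernel f ⟶ cokernel f) < Module.finrank k (x ⟶ x) by omega)
      _ rfl)

/-- The abelian structure of a finite semisimple category. -/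
abbrev IsFiniteSemisimple.abelian {D : Type (u + 1)} [Category.{u} D] [Preadditive D]
    [Linear k D] [h : IsFiniteSemisimple k D] : Abelian D where
  normalMonoOfMono := h.normalMono.normalMonoOfMono
  normalEpiOfEpi := h.normalEpi.normalEpiOfEpi
  has_finite_products := h.hasFiniteProducts
  has_kernels := h.hasKernels
  has_cokernels := h.hasCokernels

/-- Push the mono `f` out along `g`. The map from `s` to the pushout is still mono, hence has a
nonzero component into some simple summand, which is an isomorphism by Schur. Its inverse gives a
retraction onto `s`, and restricting this to `y` extends `g`. -/
lemma injective_of_simple [Abelian C] (h : ∀ x : C, IsSumOfSimples x) (s : C) [Simple s] :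
    Injective s where
  factors {x y} g f hf := by
    let m : s ⟶ pushout f g := pushout.inr f g
    have hm : Mono m := Abelian.mono_pushout_of_mono_f f g
    obtain ⟨n, t, ht, b, ⟨hb⟩, ⟨e⟩⟩ := h (pushout f g)
    obtain ⟨i, hi⟩ : ∃ i, m ≫ e.hom ≫ b.π i ≠ 0 := by
      by_contra! hcon
      have h0 : m ≫ e.hom = 0 := by
        rw [← Category.comp_id (m ≫ e.hom), ← IsBilimit.total hb, Preadditive.comp_sum]
        refine Finset.sum_eq_zero fun i _ => ?_
        rw [← Category.assoc, Category.assoc m, hcon, zero_comp]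
      refine id_nonzero s ?_
      rw [← cancel_mono (m ≫ e.hom), h0, comp_zero, comp_zero]
    have := ht i
    have := isIso_of_hom_simple hi
    refine ⟨pushout.inl f g ≫ e.hom ≫ b.π i ≫ inv (m ≫ e.hom ≫ b.π i), ?_⟩
    rw [pushout.condition_assoc]
    change g ≫ m ≫ e.hom ≫ b.π i ≫ inv (m ≫ e.hom ≫ b.π i) = g
    have h1 := IsIso.hom_inv_id (m ≫ e.hom ≫ b.π i)
    rw [Category.assoc, Category.assoc] at h1
    rw [h1, Category.comp_id]

lemma isSplitMono_of_isSumOfSimples [Abelian C] (h : ∀ x : C, IsSumOfSimples x) {x y : C}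
    (f : x ⟶ y) [Mono f] : IsSplitMono f := by
  obtain ⟨n, t, ht, b, ⟨hb⟩, ⟨e⟩⟩ := h x
  have : ∀ i, Injective (t i) := fun i => have := ht i; injective_of_simple h (t i)
  have := HasBiproduct.mk ⟨b, hb⟩
  -- A finite biproduct of injectives is injective, so the identity of `x` extends along `f`.
  have hinj : Injective x := Injective.of_iso (e ≪≫ biproduct.uniqueUpToIso t hb).symm inferInstance
  exact ⟨⟨⟨Injective.factorThru (𝟙 x) f, Injective.comp_factorThru _ _⟩⟩⟩

lemma IsFiniteSemisimple.isSplitMono {D : Type (u + 1)} [Category.{u} D] [Preadditive D]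
    [Linear k D] [h : IsFiniteSemisimple k D] {x y : D} (f : x ⟶ y) [Mono f] : IsSplitMono f :=
  let _ : Abelian D := IsFiniteSemisimple.abelian k
  isSplitMono_of_isSumOfSimples (fun x => h.semisimple x) f

lemma IsSumOfSimples.exists_simple_hom [Preadditive C] {x : C} (hx : IsSumOfSimples x)
    (h : ¬ IsZero x) : ∃ (s : C) (f : s ⟶ x), Simple s ∧ f ≠ 0 := by
  obtain ⟨n, s, hs, b, ⟨hb⟩, ⟨e⟩⟩ := hx
  obtain ⟨i, hi⟩ := exists_ι_comp_ne_zero (𝟙 x) (fun h0 => h ((IsZero.iff_id_eq_zero x).2 h0))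
    s b hb e
  exact ⟨s i, _, hs i, hi⟩

end Semisimple

/-! ### Finite groupoids and Maschke's theorem for functor categories. -/

section FiniteGroupoid

/-- A groupoid with finitely many isomorphism classes and finite hom sets. -/
class IsFiniteGroupoid (G : Type u) [Category.{u} G] : Prop where
  isIso {x y : G} (f : x ⟶ y) : IsIso f
  finite_iso_classes : Finite (Quotient (isIsomorphicSetoid G))
  finite_hom (x y : G) : Finite (x ⟶ y)

attribute [instance] IsFiniteGroupoid.isIso IsFiniteGroupoid.finite_iso_classes
  IsFiniteGroupoid.finite_hom

section

open MonoidalCategory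

/-- Tensoring further with `z` and transporting along `y ⊗ z ≅ 𝟙` undoes the tensoring with `y`. -/
lemma whiskerRight_injective {G : Type u} [Category.{u} G] [MonoidalCategory G] {x x' y z : G}
    (e : y ⊗ z ≅ 𝟙_ G) {a b : x ⟶ x'} (h : a ▷ y = b ▷ y) : a = b := by
  have h1 : a ▷ (y ⊗ z) = b ▷ (y ⊗ z) := by
    rw [whiskerRight_tensor, whiskerRight_tensor, h]
  have h2 : a ▷ 𝟙_ G = b ▷ 𝟙_ G := by
    rw [← cancel_epi (x ◁ e.hom), whisker_exchange, whisker_exchange, h1]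
  simpa using h2

/-- A morphism `f : x ⟶ y` identifies `Hom(x, y)` with `End(x)`, and tensoring with an inverse of
`x` embeds `End(x)` in the finite `End(𝟙)`. -/
instance (G : Type u) [Category.{u} G] [MonoidalCategory G] [h : IsFiniteTwoGroup G] :
    IsFiniteGroupoid G where
  isIso := h.isIso
  finite_iso_classes := h.finite_pi_one
  finite_hom x y := by
    rcases isEmpty_or_nonempty (x ⟶ y) with _ | ⟨⟨f⟩⟩
    · infer_instance
    have := h.isIso f
    have := h.finite_pi_two
    obtain ⟨z, ⟨e⟩, ⟨e'⟩⟩ := h.invertible x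
    refine Finite.of_injective (fun a : x ⟶ y => e.inv ≫ (a ≫ inv f) ▷ z ≫ e.hom) fun a b hab => ?_
    have h1 : (a ≫ inv f) ▷ z = (b ≫ inv f) ▷ z := by
      simpa only [cancel_epi, cancel_mono] using hab
    simpa using whiskerRight_injective e' h1

end

variable {G : Type u} [Category.{u} G]

variable (G) in
/-- The set of isomorphism classes of objects. -/
abbrev IsoClasses : Type u := Quotient (isIsomorphicSetoid G)

/-- A representative of an isomorphism class. -/
noncomputable abbrev rep (i : IsoClasses G) : G := Quotient.out i

lemma exists_rep_iso (x : G) : ∃ i : IsoClasses G, Nonempty (rep i ≅ x) :=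
  ⟨Quotient.mk _ x, Quotient.exact (Quotient.out_eq (Quotient.mk (isIsomorphicSetoid G) x))⟩

lemma hom_ext_of_rep {D : Type*} [Category* D] {F H : G ⥤ D} {f g : F ⟶ H}
    (h : ∀ i : IsoClasses G, f.app (rep i) = g.app (rep i)) : f = g := by
  ext x
  obtain ⟨i, ⟨e⟩⟩ := exists_rep_iso x
  rw [← cancel_epi (F.map e.hom), f.naturality, g.naturality, h]

/-- The morphisms to `x` from the representatives of the isomorphism classes. -/
abbrev RepHom (x : G) : Type u := Σ i : IsoClasses G, (rep i ⟶ x)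

/-- Composition with an isomorphism. -/
noncomputable def repHomEquiv {x y : G} (g : x ⟶ y) [IsIso g] : RepHom x ≃ RepHom y where
  toFun p := ⟨p.1, p.2 ≫ g⟩
  invFun p := ⟨p.1, p.2 ≫ inv g⟩
  left_inv p := by simp
  right_inv p := by simp

variable [IsFiniteGroupoid G] (k : Type u) [Field k]
  {D : Type (u + 1)} [Category.{u} D] [Preadditive D]

noncomputable instance (x : G) : Fintype (RepHom x) := Fintype.ofFinite _

noncomputable instance (x y : G) : Fintype (x ⟶ y) := Fintype.ofFinite _

/-- Maschke's argument. Pointwise retractions need not be natural, so those at the representatives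
are transported to `x` along every `p : RepHom x` and averaged. Postcomposition with `g : x ⟶ y`
permutes the terms (`ht`), which gives naturality; each term retracts `f` at `x` (`hft`), hence so
does the average. -/
lemma isSplitMono_functor [CharZero k] [Linear k D] {F H : G ⥤ D} (f : F ⟶ H)
    (hf : ∀ x, IsSplitMono (f.app x)) : IsSplitMono f := by
  let r (x : G) : H.obj x ⟶ F.obj x := retraction (f.app x)
  let t (x : G) (p : RepHom x) : H.obj x ⟶ F.obj x :=
    H.map (inv p.2) ≫ r (rep p.1) ≫ F.map p.2
  have ht (x y : G) (g : x ⟶ y) (p : RepHom x) :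
      H.map g ≫ t y (repHomEquiv g p) = t x p ≫ F.map g := by
    simp [t, repHomEquiv]
  have hft (x : G) (p : RepHom x) : f.app x ≫ t x p = 𝟙 _ := by
    simp only [t, r]
    rw [← NatTrans.naturality_assoc, IsSplitMono.id_assoc, ← F.map_comp, IsIso.inv_hom_id,
      F.map_id]
  refine ⟨⟨{
    retraction :=
      { app := fun x => (Fintype.card (RepHom x) : k)⁻¹ • ∑ p : RepHom x, t x p
        naturality := fun x y g => ?_ }
    id := ?_ }⟩⟩
  · rw [Linear.comp_smul, Linear.smul_comp, Preadditive.comp_sum, Preadditive.sum_comp,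
      ← Fintype.card_congr (repHomEquiv g), ← (repHomEquiv g).sum_comp]
    simp_rw [ht]
  · ext x
    -- `x` is isomorphic to some representative, so the average is over a nonempty set and its size
    -- is invertible in characteristic zero.
    have hne : (Fintype.card (RepHom x) : k) ≠ 0 := by
      obtain ⟨i, ⟨e⟩⟩ := exists_rep_iso x
      have : Nonempty (RepHom x) := ⟨⟨i, e.hom⟩⟩
      exact Nat.cast_ne_zero.2 Fintype.card_ne_zero
    rw [NatTrans.comp_app, Linear.comp_smul, Preadditive.comp_sum]
    simp_rw [hft]
    rw [Finset.sum_const, Finset.card_univ, ← Nat.cast_smul_eq_nsmul k, smul_smul,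
      inv_mul_cancel₀ hne, one_smul]
    rfl

lemma finite_hom_functor [Linear k D] (hfin : ∀ x y : D, Module.Finite k (x ⟶ y))
    (F H : G ⥤ D) : Module.Finite k (F ⟶ H) := by
  let T : (F ⟶ H) →ₗ[k] (∀ i : IsoClasses G, (F.obj (rep i) ⟶ H.obj (rep i))) :=
    { toFun := fun f i => f.app (rep i)
      map_add' := fun f g => rfl
      map_smul' := fun c f => rfl }
  exact Module.Finite.of_injective T fun f g h => hom_ext_of_rep fun i => congrFun h i

/-- The functor freely generated by an object `s` placed at `x`. -/
@[simps]
noncomputable def freeFunctor [HasFiniteBiproducts D] (x : G) (s : D) : G ⥤ D where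
  obj y := ⨁ fun _ : (x ⟶ y) => s
  map g := biproduct.desc fun a => biproduct.ι (fun _ => s) (a ≫ g)
  map_id y := by ext; simp
  map_comp g h := by ext; simp

/-- The Yoneda-type extension of `t` sends the summand at `a` to `t ≫ F.map a`; the summand at `𝟙 x`
recovers `t`, so the extension is nonzero. -/
lemma exists_freeFunctor_hom [HasFiniteBiproducts D] (x : G) (s : D) (F : G ⥤ D)
    (t : s ⟶ F.obj x) (ht : t ≠ 0) : ∃ f : freeFunctor x s ⟶ F, f ≠ 0 := by
  refine ⟨{ app := fun y => biproduct.desc fun a => t ≫ F.map a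
            naturality := fun y z g => ?_ }, fun h => ht ?_⟩
  · apply biproduct.hom_ext'
    intro a
    change biproduct.ι (fun _ : (x ⟶ y) => s) a ≫
        biproduct.desc (fun a => biproduct.ι (fun _ : (x ⟶ z) => s) (a ≫ g)) ≫
          biproduct.desc (fun a => t ≫ F.map a) =
      biproduct.ι (fun _ : (x ⟶ y) => s) a ≫ biproduct.desc (fun a => t ≫ F.map a) ≫ F.map g
    simp
  · have h' : biproduct.desc (fun a : x ⟶ x => t ≫ F.map a) = 0 := NatTrans.congr_app h x
    simpa using biproduct.ι (fun _ : (x ⟶ x) => s) (𝟙 x) ≫= h'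

variable (G D) in
/-- Functors from a finite groupoid to a finite semisimple category form a finite semisimple
category. -/
instance isFiniteSemisimple_functor [CharZero k] [Linear k D] [hD : IsFiniteSemisimple k D] :
    IsFiniteSemisimple k (G ⥤ D) := by
  let _ : Abelian D := IsFiniteSemisimple.abelian k
  have : HasFiniteBiproducts D := HasFiniteBiproducts.of_hasFiniteProducts
  have hfin := finite_hom_functor (G := G) k hD.finite_hom
  have hsum (F : G ⥤ D) : IsSumOfSimples F :=
    isSumOfSimples_of_isSplitMono k hfin
      (fun f hf => isSplitMono_functor k f fun x => IsFiniteSemisimple.isSplitMono k (f.app x)) F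
  refine
    { hasFiniteProducts := inferInstance
      hasKernels := inferInstance
      hasCokernels := inferInstance
      normalMono := inferInstance
      normalEpi := inferInstance
      finite_hom := hfin
      finite_simples := ?_
      semisimple := hsum }
  obtain ⟨n, s, hs⟩ := hD.finite_simples
  -- The finite list of candidate simples: all simple summands of the free functors on a simple of
  -- `D` placed at a representative.
  choose m t ht b hb e using fun p : IsoClasses G × Fin n => hsum (freeFunctor (rep p.1) (s p.2))
  obtain ⟨N, ⟨φ⟩⟩ := Finite.exists_equiv_fin (Σ p, Fin (m p))
  refine ⟨N, fun i => t (φ.symm i).1 (φ.symm i).2, fun F hF => ?_⟩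
  -- A simple `F` is nonzero at some representative, where a simple of `D` maps to it nontrivially.
  -- The resulting map from a free functor is nonzero on some simple summand, which is isomorphic to
  -- `F` by Schur.
  obtain ⟨i, hi⟩ : ∃ i : IsoClasses G, ¬ IsZero (F.obj (rep i)) := by
    by_contra! hcon
    exact id_nonzero F (hom_ext_of_rep fun i => (hcon i).eq_of_src _ _)
  obtain ⟨s', f, hs', hf⟩ := IsSumOfSimples.exists_simple_hom (hD.semisimple (F.obj (rep i))) hi
  obtain ⟨j, ⟨e'⟩⟩ := hs s' hs'
  obtain ⟨g, hg⟩ := exists_freeFunctor_hom (rep i) (s j) F (e'.inv ≫ f)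
    (fun h => hf (by rwa [← cancel_epi e'.inv, comp_zero]))
  obtain ⟨l, hl⟩ := exists_ι_comp_ne_zero g hg _ _ (hb (i, j)).some (e (i, j)).some
  have := ht (i, j) l
  have := isIso_of_hom_simple hl
  refine ⟨φ ⟨(i, j), l⟩, ?_⟩
  dsimp only
  rw [φ.symm_apply_apply]
  exact ⟨(asIso ((b (i, j)).ι l ≫ (e (i, j)).some.inv ≫ g)).symm⟩

end FiniteGroupoid

/-! ### 2-representations as actions, and the cofree 2-representation. -/

section Action

open MonoidalCategory

variable {k : Type u} [Field k] {G : Type u} [Category.{u} G] [MonoidalCategory G]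

namespace TwoRep

variable (V : TwoRep k G)

/-- The category on which a 2-representation acts. -/
abbrev Carrier : Type (u + 1) := (V.obj .pt).carrier

/-- The action `g · -` of an object of `G`. -/
def act (g : G) : V.Carrier ⥤ V.Carrier :=
  TwoVect.Hom.functor (V.map (X := .pt) (Y := .pt) g)

instance (g : G) : (V.act g).Additive :=
  TwoVect.Hom.additive (V.map (X := .pt) (Y := .pt) g)

instance (g : G) : (V.act g).Linear k :=
  TwoVect.Hom.linear (V.map (X := .pt) (Y := .pt) g)

/-- The action of a morphism of `G`. -/
def actMap {g g' : G} (η : g ⟶ g') : V.act g ⟶ V.act g' :=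
  TwoVect.Hom₂.nat (V.map₂ (a := .pt) (b := .pt) η)

/-- An isomorphism of 1-morphisms of `2Vect` as a natural isomorphism. -/
@[simps]
def _root_.TwoRepTheory.TwoVect.natIso {C D : TwoVect k} {F H : C ⟶ D} (e : F ≅ H) :
    TwoVect.Hom.functor F ≅ TwoVect.Hom.functor H where
  hom := TwoVect.Hom₂.nat e.hom
  inv := TwoVect.Hom₂.nat e.inv
  hom_inv_id := by rw [← TwoVect.comp_nat, e.hom_inv_id]; rfl
  inv_hom_id := by rw [← TwoVect.comp_nat, e.inv_hom_id]; rfl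

/-- The isomorphism `𝟙 · a ≅ a`. -/
def unitIso (a : V.Carrier) : (V.act (𝟙_ G)).obj a ≅ a :=
  (TwoVect.natIso (V.mapId .pt)).app a

/-- The isomorphism `(g ⊗ f) · a ≅ g · (f · a)`. -/
def tensorIso (g f : G) (a : V.Carrier) : (V.act (g ⊗ f)).obj a ≅ (V.act g).obj ((V.act f).obj a) :=
  (TwoVect.natIso (V.mapComp (a := .pt) (b := .pt) (c := .pt) f g)).app a

lemma unitIso_naturality {a b : V.Carrier} (t : a ⟶ b) :
    (V.act (𝟙_ G)).map t ≫ (V.unitIso b).hom = (V.unitIso a).hom ≫ t :=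
  (TwoVect.natIso (V.mapId .pt)).hom.naturality t

lemma tensorIso_naturality (g f : G) {a b : V.Carrier} (t : a ⟶ b) :
    (V.act (g ⊗ f)).map t ≫ (V.tensorIso g f b).hom =
      (V.tensorIso g f a).hom ≫ (V.act g).map ((V.act f).map t) :=
  (TwoVect.natIso (V.mapComp (a := .pt) (b := .pt) (c := .pt) f g)).hom.naturality t

variable (a : V.Carrier)

lemma actMap_id (g : G) : V.actMap (𝟙 g) = 𝟙 _ :=
  congrArg TwoVect.Hom₂.nat (V.map₂_id (a := .pt) (b := .pt) g)

lemma actMap_comp {g g' g'' : G} (η : g ⟶ g') (θ : g' ⟶ g'') :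
    V.actMap (η ≫ θ) = V.actMap η ≫ V.actMap θ :=
  congrArg TwoVect.Hom₂.nat (V.map₂_comp (a := .pt) (b := .pt) η θ)

lemma _root_.TwoRepTheory.TwoVect.congr_nat_app {C D : TwoVect k} {F H : C ⟶ D} {α β : F ⟶ H}
    (h : α = β) (x : C.carrier) :
    (TwoVect.Hom₂.nat α).app x = (TwoVect.Hom₂.nat β).app x := by
  rw [h]

/-- Composition in the delooping reverses `⊗`, so the pseudofunctor axiom for left whiskering is
about `▷` in `G`, and vice versa in the next lemma. -/
lemma actMap_whiskerRight_tensor {g g' : G} (η : g ⟶ g') (f : G) :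
    (V.actMap (η ▷ f)).app a ≫ (V.tensorIso g' f a).hom =
      (V.tensorIso g f a).hom ≫ (V.actMap η).app ((V.act f).obj a) := by
  have h : (V.actMap (η ▷ f)).app a = (V.tensorIso g f a).hom ≫
      (V.actMap η).app ((V.act f).obj a) ≫ (V.tensorIso g' f a).inv :=
    TwoVect.congr_nat_app (V.map₂_whisker_left (a := .pt) (b := .pt) (c := .pt) f η) a
  rw [h, Category.assoc, Category.assoc, Iso.inv_hom_id, Category.comp_id]

lemma actMap_whiskerLeft_tensor (g : G) {f f' : G} (η : f ⟶ f') :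
    (V.actMap (g ◁ η)).app a ≫ (V.tensorIso g f' a).hom =
      (V.tensorIso g f a).hom ≫ (V.act g).map ((V.actMap η).app a) := by
  have h : (V.actMap (g ◁ η)).app a = (V.tensorIso g f a).hom ≫
      (V.act g).map ((V.actMap η).app a) ≫ (V.tensorIso g f' a).inv :=
    TwoVect.congr_nat_app (V.map₂_whisker_right (a := .pt) (b := .pt) (c := .pt) η g) a
  rw [h, Category.assoc, Category.assoc, Iso.inv_hom_id, Category.comp_id]

lemma actMap_associator_inv (h g f : G) :
    (V.actMap (α_ h g f).inv).app a = (V.tensorIso h (g ⊗ f) a).hom ≫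
      (V.act h).map (V.tensorIso g f a).hom ≫
        (V.tensorIso h g ((V.act f).obj a)).inv ≫ (V.tensorIso (h ⊗ g) f a).inv := by
  have e : (V.actMap (α_ h g f).inv).app a = (V.tensorIso h (g ⊗ f) a).hom ≫
      (V.act h).map (V.tensorIso g f a).hom ≫ 𝟙 _ ≫
        (V.tensorIso h g ((V.act f).obj a)).inv ≫ (V.tensorIso (h ⊗ g) f a).inv :=
    TwoVect.congr_nat_app (V.map₂_associator (a := .pt) (b := .pt) (c := .pt) (d := .pt) f g h) a
  rw [e, Category.id_comp]

lemma actMap_rightUnitor (f : G) :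
    (V.actMap (ρ_ f).hom).app a =
      (V.tensorIso f (𝟙_ G) a).hom ≫ (V.act f).map (V.unitIso a).hom := by
  have e : (V.actMap (ρ_ f).hom).app a =
      (V.tensorIso f (𝟙_ G) a).hom ≫ (V.act f).map (V.unitIso a).hom ≫ 𝟙 _ :=
    TwoVect.congr_nat_app (V.map₂_left_unitor (a := .pt) (b := .pt) f) a
  rw [e, Category.comp_id]

end TwoRep

variable (k G) in
/-- The right translation on `Fun(G, C)`. -/
@[simps! obj_obj obj_map map_app]
def translation (C : TwoVect k) (g : G) : (G ⥤ C.carrier) ⥤ (G ⥤ C.carrier) :=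
  (Functor.whiskeringLeft G G C.carrier).obj (tensorRight g)

instance (C : TwoVect k) (g : G) : (translation k G C g).Additive where

instance (C : TwoVect k) (g : G) : (translation k G C g).Linear k where

variable [CharZero k] [IsFiniteGroupoid G]

variable (G) in
/-- The category `Fun(G, C)` as an object of `2Vect`. -/
abbrev functorTwoVect (C : TwoVect k) : TwoVect k where
  carrier := G ⥤ C.carrier

variable (G) in
/-- The category `Fun(G, C)` with the left `G`-action by right translation. -/
def cofreeRep (C : TwoVect k) : TwoRep k G where
  obj _ := functorTwoVect G C
  map g := TwoVect.Hom.mk (translation k G C g)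
  map₂ a := TwoVect.Hom₂.mk
    ((Functor.whiskeringLeft G G C.carrier).map ((curriedTensor G).flip.map a))
  mapId _ := TwoVect.mkIso ((Functor.whiskeringLeft G G C.carrier).mapIso (rightUnitorNatIso G))
  mapComp f g :=
    TwoVect.mkIso ((Functor.whiskeringLeft G G C.carrier).mapIso (tensorRightTensor g f))
  map₂_id f := TwoVect.hom₂_ext fun F => NatTrans.ext (funext fun x => by
    change F.map (x ◁ 𝟙 (f : G)) = 𝟙 (F.obj (x ⊗ (f : G)))
    simp)
  map₂_comp {_ _ f g g'} η θ := TwoVect.hom₂_ext fun F => NatTrans.ext (funext fun x => by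
    change F.map (x ◁ ((η : (f : G) ⟶ g) ≫ (θ : (g : G) ⟶ g'))) =
      F.map (x ◁ (η : (f : G) ⟶ g)) ≫ F.map (x ◁ (θ : (g : G) ⟶ g'))
    simp)
  map₂_whisker_left f g g' η := TwoVect.hom₂_ext fun F => NatTrans.ext (funext fun x => by
    change F.map (x ◁ ((η : (g : G) ⟶ g') ▷ (f : G))) =
      F.map (α_ x g f).inv ≫ F.map ((x ◁ (η : (g : G) ⟶ g')) ▷ (f : G)) ≫ F.map (α_ x g' f).hom
    simp only [← F.map_comp]
    congr 1
    simp)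
  map₂_whisker_right {_ _ _ f f'} η g := TwoVect.hom₂_ext fun F =>
    NatTrans.ext (funext fun x => by
      change F.map (x ◁ ((g : G) ◁ (η : (f : G) ⟶ f'))) =
        F.map (α_ x g f).inv ≫ F.map ((x ⊗ (g : G)) ◁ (η : (f : G) ⟶ f')) ≫
          F.map (α_ x g f').hom
      simp only [← F.map_comp]
      congr 1
      simp)
  map₂_associator f g h := TwoVect.hom₂_ext fun F => NatTrans.ext (funext fun x => by
    change F.map (x ◁ (α_ (h : G) g f).inv) =
      F.map (α_ x h ((g : G) ⊗ (f : G))).inv ≫ F.map (α_ (x ⊗ (h : G)) g f).inv ≫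
        𝟙 (F.obj (((x ⊗ (h : G)) ⊗ (g : G)) ⊗ (f : G))) ≫
        F.map ((α_ x (h : G) g).hom ▷ (f : G)) ≫ F.map (α_ x ((h : G) ⊗ (g : G)) f).hom
    rw [Category.id_comp]
    simp only [← F.map_comp]
    congr 1
    monoidal_coherence)
  map₂_left_unitor f := TwoVect.hom₂_ext fun F => NatTrans.ext (funext fun x => by
    change F.map (x ◁ (ρ_ (f : G)).hom) =
      F.map (α_ x (f : G) (𝟙_ G)).inv ≫ F.map (ρ_ (x ⊗ (f : G))).hom ≫
        𝟙 (F.obj (x ⊗ (f : G)))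
    rw [Category.comp_id, ← F.map_comp]
    congr 1
    monoidal_coherence)
  map₂_right_unitor f := TwoVect.hom₂_ext fun F => NatTrans.ext (funext fun x => by
    change F.map (x ◁ (λ_ (f : G)).hom) =
      F.map (α_ x (𝟙_ G) (f : G)).inv ≫ F.map ((ρ_ x).hom ▷ (f : G)) ≫
        𝟙 (F.obj (x ⊗ (f : G)))
    rw [Category.comp_id, ← F.map_comp]
    congr 1
    monoidal_coherence)

variable (G) in
/-- Evaluation at the tensor unit, `Fun(G, C) ⥤ C`. -/
def evalOne (C : TwoVect k) : (forgetful k G).obj (cofreeRep G C) ⟶ C :=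
  TwoVect.Hom.mk ((evaluation G C.carrier).obj (𝟙_ G))
    (additive := { }) (linear := { })

end Action

/-! ### The universal property of the cofree 2-representation. -/

section Universal

open MonoidalCategory

variable {k : Type u} [Field k] {G : Type u} [Category.{u} G] [MonoidalCategory G]
  [CharZero k] [IsFiniteGroupoid G] {V : TwoRep k G} {C : TwoVect k}

namespace EquivariantFunctor

variable (φ ψ : V ⟶ cofreeRep G C)

/-- The functor underlying a 1-morphism to `Fun(G, C)`. -/
def toFunctor : V.Carrier ⥤ (G ⥤ C.carrier) :=
  TwoVect.Hom.functor (φ.app .pt)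

/-- The equivariance isomorphism `φ (g · a) x ≅ φ a (x ⊗ g)`. -/
def equivariance (g : G) (a : V.Carrier) (x : G) :
    ((toFunctor φ).obj ((V.act g).obj a)).obj x ≅ ((toFunctor φ).obj a).obj (x ⊗ g) :=
  ((TwoVect.natIso (φ.naturality (a := .pt) (b := .pt) g)).app a).app x

variable (a : V.Carrier)

lemma congr_nat_app_app {H : Type u} [Category.{u} H] [IsFiniteGroupoid H] {D : TwoVect k}
    {F F' : D ⟶ functorTwoVect H C} {α β : F ⟶ F'} (h : α = β) (y : D.carrier) (x : H) :
    NatTrans.app (F := (TwoVect.Hom.functor F).obj y) (G := (TwoVect.Hom.functor F').obj y)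
      ((TwoVect.Hom₂.nat α).app y) x =
    NatTrans.app (F := (TwoVect.Hom.functor F).obj y) (G := (TwoVect.Hom.functor F').obj y)
      ((TwoVect.Hom₂.nat β).app y) x := by
  rw [h]

lemma equivariance_naturality_left {a b : V.Carrier} (t : a ⟶ b) (g x : G) :
    ((toFunctor φ).map ((V.act g).map t)).app x ≫ (equivariance φ g b x).hom =
      (equivariance φ g a x).hom ≫ ((toFunctor φ).map t).app (x ⊗ g) :=
  NatTrans.congr_app
    ((TwoVect.natIso (φ.naturality (a := .pt) (b := .pt) g)).hom.naturality t) x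

lemma equivariance_naturality_right (g : G) {x y : G} (s : x ⟶ y) :
    ((toFunctor φ).obj ((V.act g).obj a)).map s ≫ (equivariance φ g a y).hom =
      (equivariance φ g a x).hom ≫ ((toFunctor φ).obj a).map (s ▷ g) :=
  ((TwoVect.natIso (φ.naturality (a := .pt) (b := .pt) g)).hom.app a).naturality s

lemma equivariance_naturality {g g' : G} (η : g ⟶ g') (x : G) :
    ((toFunctor φ).map ((V.actMap η).app a)).app x ≫ (equivariance φ g' a x).hom =
      (equivariance φ g a x).hom ≫ ((toFunctor φ).obj a).map (x ◁ η) :=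
  congr_nat_app_app (φ.naturality_naturality (a := .pt) (b := .pt) η) a x

lemma equivariance_unit (x : G) :
    (equivariance φ (𝟙_ G) a x).hom ≫ ((toFunctor φ).obj a).map (ρ_ x).hom =
      ((toFunctor φ).map (V.unitIso a).hom).app x := by
  have h : (equivariance φ (𝟙_ G) a x).hom ≫ ((toFunctor φ).obj a).map (ρ_ x).hom =
      ((toFunctor φ).map (V.unitIso a).hom).app x ≫ 𝟙 _ ≫ 𝟙 _ :=
    congr_nat_app_app (φ.naturality_id .pt) a x
  rw [h, Category.comp_id, Category.comp_id]

lemma equivariance_tensor (g f x : G) :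
    (equivariance φ (g ⊗ f) a x).hom ≫ ((toFunctor φ).obj a).map (α_ x g f).inv =
      ((toFunctor φ).map (V.tensorIso g f a).hom).app x ≫
        (equivariance φ g ((V.act f).obj a) x).hom ≫ (equivariance φ f a (x ⊗ g)).hom := by
  have h : (equivariance φ (g ⊗ f) a x).hom ≫
        ((toFunctor φ).obj a).map (α_ x g f).inv =
      ((toFunctor φ).map (V.tensorIso g f a).hom).app x ≫ 𝟙 _ ≫
        (equivariance φ g ((V.act f).obj a) x).hom ≫ 𝟙 _ ≫
          (equivariance φ f a (x ⊗ g)).hom ≫ 𝟙 (((toFunctor φ).obj a).obj ((x ⊗ g) ⊗ f)) :=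
    congr_nat_app_app (φ.naturality_comp (a := .pt) (b := .pt) (c := .pt) f g) a x
  rw [h]
  simp only [Category.id_comp, Category.comp_id]

/-- The isomorphism `φ (x · a) (𝟙) ≅ φ a x`. -/
def evalIso (x : G) :
    ((toFunctor φ).obj ((V.act x).obj a)).obj (𝟙_ G) ≅ ((toFunctor φ).obj a).obj x :=
  equivariance φ x a (𝟙_ G) ≪≫ ((toFunctor φ).obj a).mapIso (λ_ x)

lemma evalIso_hom (x : G) : (evalIso φ a x).hom =
    (equivariance φ x a (𝟙_ G)).hom ≫ ((toFunctor φ).obj a).map (λ_ x).hom := rfl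

lemma evalIso_naturality {a b : V.Carrier} (t : a ⟶ b) (x : G) :
    ((toFunctor φ).map ((V.act x).map t)).app (𝟙_ G) ≫ (evalIso φ b x).hom =
      (evalIso φ a x).hom ≫ ((toFunctor φ).map t).app x := by
  rw [evalIso_hom, evalIso_hom, reassoc_of% @equivariance_naturality_left, Category.assoc,
    NatTrans.naturality]

lemma evalIso_map {x y : G} (s : x ⟶ y) :
    ((toFunctor φ).map ((V.actMap s).app a)).app (𝟙_ G) ≫ (evalIso φ a y).hom =
      (evalIso φ a x).hom ≫ ((toFunctor φ).obj a).map s := by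
  rw [evalIso_hom, evalIso_hom, reassoc_of% @equivariance_naturality,
    Category.assoc, ← Functor.map_comp, ← Functor.map_comp, leftUnitor_naturality]

/-- Recovers the equivariance of `φ` from the isomorphisms `evalIso`. This is what makes a
transformation defined only at `𝟙` extend equivariantly. -/
lemma evalIso_equivariance (g x : G) :
    ((toFunctor φ).map (V.tensorIso x g a).hom).app (𝟙_ G) ≫
      (evalIso φ ((V.act g).obj a) x).hom ≫ (equivariance φ g a x).hom =
        (evalIso φ a (x ⊗ g)).hom := by
  have h : (λ_ (x ⊗ g)).hom = (α_ (𝟙_ G) x g).inv ≫ (λ_ x).hom ▷ g := by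
    simp
  rw [evalIso_hom, evalIso_hom, Category.assoc, equivariance_naturality_right, h,
    Functor.map_comp, reassoc_of% @equivariance_tensor]

lemma evalIso_unit : (evalIso φ a (𝟙_ G)).hom =
    ((toFunctor φ).map (V.unitIso a).hom).app (𝟙_ G) := by
  rw [evalIso_hom, ← equivariance_unit, unitors_equal]

variable {φ ψ}

/-- The natural transformation underlying a 2-morphism. -/
def toNatTrans (Γ : φ ⟶ ψ) : toFunctor φ ⟶ toFunctor ψ :=
  TwoVect.Hom₂.nat (Γ.as.app .pt)

lemma toNatTrans_equivariance (Γ : φ ⟶ ψ) (g x : G) :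
    ((toNatTrans Γ).app ((V.act g).obj a)).app x ≫ (equivariance ψ g a x).hom =
      (equivariance φ g a x).hom ≫ ((toNatTrans Γ).app a).app (x ⊗ g) :=
  congr_nat_app_app (Γ.as.naturality (a := .pt) (b := .pt) g) a x

/-- The component at `(a, x)` is conjugate to the one at `(x · a, 𝟙)`. This gives faithfulness and
dictates the formula in `extend`. -/
lemma toNatTrans_evalIso (Γ : φ ⟶ ψ) (x : G) :
    ((toNatTrans Γ).app ((V.act x).obj a)).app (𝟙_ G) ≫ (evalIso ψ a x).hom =
      (evalIso φ a x).hom ≫ ((toNatTrans Γ).app a).app x := by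
  rw [evalIso_hom, evalIso_hom, reassoc_of% @toNatTrans_equivariance,
    Category.assoc, ← NatTrans.naturality]

section Extend

variable (γ : ∀ a : V.Carrier, ((toFunctor φ).obj a).obj (𝟙_ G) ⟶ ((toFunctor ψ).obj a).obj (𝟙_ G))
  (hγ : ∀ {a b : V.Carrier} (t : a ⟶ b), ((toFunctor φ).map t).app (𝟙_ G) ≫ γ b =
    γ a ≫ ((toFunctor ψ).map t).app (𝟙_ G))

/-- The natural transformation of which `γ` is the value at the tensor unit. -/
@[simps]
def extend : toFunctor φ ⟶ toFunctor ψ where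
  app a :=
    { app := fun x => (evalIso φ a x).inv ≫ γ ((V.act x).obj a) ≫ (evalIso ψ a x).hom
      naturality := fun x y s => by
        rw [← cancel_epi (evalIso φ a x).hom, ← reassoc_of% @evalIso_map, Iso.hom_inv_id_assoc,
          reassoc_of% hγ, evalIso_map, Category.assoc, Category.assoc, Iso.hom_inv_id_assoc] }
  naturality a b t := by
    ext x
    dsimp
    rw [← cancel_epi (evalIso φ a x).hom, ← reassoc_of% @evalIso_naturality, Iso.hom_inv_id_assoc,
      reassoc_of% hγ, evalIso_naturality, Category.assoc, Category.assoc, Iso.hom_inv_id_assoc]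

lemma extend_equivariance (g x : G) :
    ((extend γ hγ).app ((V.act g).obj a)).app x ≫ (equivariance ψ g a x).hom =
      (equivariance φ g a x).hom ≫ ((extend γ hγ).app a).app (x ⊗ g) := by
  -- After precomposing with two isomorphisms, both sides become `γ` at `(x ⊗ g) · a`, by naturality
  -- of `γ` along `tensorIso`.
  rw [extend_app_app, extend_app_app, ← cancel_epi (evalIso φ ((V.act g).obj a) x).hom,
    ← cancel_epi (((toFunctor φ).map (V.tensorIso x g a).hom).app (𝟙_ G)),
    reassoc_of% @evalIso_equivariance, Iso.hom_inv_id_assoc, Category.assoc, Category.assoc,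
    Iso.hom_inv_id_assoc, reassoc_of% hγ, evalIso_equivariance]

/-- The 2-morphism of which `γ` is the value at the tensor unit. -/
def extendHom : φ ⟶ ψ :=
  Pseudofunctor.StrongTrans.Hom.of
    { app := fun _ => TwoVect.Hom₂.mk (extend γ hγ)
      naturality := fun g => TwoVect.hom₂_ext fun a => NatTrans.ext (funext fun x =>
        extend_equivariance a γ hγ g x) }

lemma extend_app_app_unit : ((extend γ hγ).app a).app (𝟙_ G) = γ a := by
  rw [extend_app_app, Iso.inv_comp_eq, evalIso_unit, evalIso_unit, hγ]

end Extend

end EquivariantFunctor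

open EquivariantFunctor

instance faithful_transpose : (transpose (forgetful k G) (evalOne G C) V).Faithful where
  map_injective {_ _ Γ Δ} h := by
    have h1 (a : V.Carrier) : ((toNatTrans Γ).app a).app (𝟙_ G) =
        ((toNatTrans Δ).app a).app (𝟙_ G) :=
      TwoVect.congr_nat_app h a
    have h2 : toNatTrans Γ = toNatTrans Δ := by
      ext a x
      rw [← cancel_epi (evalIso _ a x).hom, ← toNatTrans_evalIso, ← toNatTrans_evalIso, h1]
    exact Pseudofunctor.StrongTrans.homCategory.ext fun _ => TwoVect.Hom₂.ext h2

instance full_transpose : (transpose (forgetful k G) (evalOne G C) V).Full where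
  map_surjective γ :=
    ⟨extendHom (TwoVect.Hom₂.nat γ).app fun t => (TwoVect.Hom₂.nat γ).naturality t,
      TwoVect.hom₂_ext fun a => extend_app_app_unit a (TwoVect.Hom₂.nat γ).app
        fun t => (TwoVect.Hom₂.nat γ).naturality t⟩

/-- The functor `x ↦ L (x · a)`. -/
@[simps]
def orbitFunctor (L : V.Carrier ⥤ C.carrier) (a : V.Carrier) : G ⥤ C.carrier where
  obj x := L.obj ((V.act x).obj a)
  map s := L.map ((V.actMap s).app a)
  map_id x := by rw [TwoRep.actMap_id, NatTrans.id_app, L.map_id]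
  map_comp s t := by rw [TwoRep.actMap_comp, NatTrans.comp_app, L.map_comp]

/-- The functor `a ↦ (x ↦ L (x · a))`. -/
@[simps]
def coinduceFunctor (L : V.Carrier ⥤ C.carrier) : V.Carrier ⥤ (G ⥤ C.carrier) where
  obj a := orbitFunctor L a
  map {a b} t :=
    { app := fun x => L.map ((V.act x).map t)
      naturality := fun x y s => by
        change L.map ((V.actMap s).app a) ≫ L.map ((V.act y).map t) =
          L.map ((V.act x).map t) ≫ L.map ((V.actMap s).app b)
        rw [← L.map_comp, ← L.map_comp, NatTrans.naturality] }
  map_id a := by ext x; exact (congrArg L.map ((V.act x).map_id a)).trans (L.map_id _)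
  map_comp s t := by
    ext x; exact (congrArg L.map ((V.act x).map_comp s t)).trans (L.map_comp _ _)

instance (L : V.Carrier ⥤ C.carrier) [L.Additive] : (coinduceFunctor L).Additive where
  map_add {a b f g} := by
    ext x
    exact (congrArg L.map (V.act x).map_add).trans L.map_add

instance (L : V.Carrier ⥤ C.carrier) [L.Additive] [L.Linear k] :
    (coinduceFunctor L).Linear k where
  map_smul f r := by
    ext x
    exact (congrArg L.map ((V.act x).map_smul r f)).trans (L.map_smul r _)

/-- The isomorphism `L (x · (g · a)) ≅ L ((x ⊗ g) · a)`, natural in `x`. -/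
def orbitIso (L : V.Carrier ⥤ C.carrier) (g : G) (a : V.Carrier) :
    orbitFunctor L ((V.act g).obj a) ≅ (translation k G C g).obj (orbitFunctor L a) :=
  NatIso.ofComponents (fun x => L.mapIso (V.tensorIso x g a).symm) (fun {x y} s => by
    change L.map ((V.actMap s).app ((V.act g).obj a)) ≫ L.map (V.tensorIso y g a).inv =
      L.map (V.tensorIso x g a).inv ≫ L.map ((V.actMap (s ▷ g)).app a)
    rw [← L.map_comp, ← L.map_comp]
    congr 1
    rw [Iso.eq_inv_comp, ← reassoc_of% @TwoRep.actMap_whiskerRight_tensor, Iso.hom_inv_id,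
      Category.comp_id])

/-- The isomorphism `L (x · (g · a)) ≅ L ((x ⊗ g) · a)`, natural in `x` and `a`. -/
def coinduceIso (L : V.Carrier ⥤ C.carrier) (g : G) :
    V.act g ⋙ coinduceFunctor L ≅ coinduceFunctor L ⋙ translation k G C g :=
  NatIso.ofComponents (fun a => orbitIso L g a) (fun {a b} t => by
    ext x
    change L.map ((V.act x).map ((V.act g).map t)) ≫ L.map (V.tensorIso x g b).inv =
      L.map (V.tensorIso x g a).inv ≫ L.map ((V.act (x ⊗ g)).map t)
    rw [← L.map_comp, ← L.map_comp]
    congr 1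
    rw [Iso.eq_inv_comp, ← reassoc_of% @TwoRep.tensorIso_naturality, Iso.hom_inv_id,
      Category.comp_id])

/-- The 1-morphism to `Fun(G, C)` induced by a linear functor to `C`. -/
def coinduce (L : V.obj .pt ⟶ C) : V ⟶ cofreeRep G C where
  app _ := TwoVect.Hom.mk (coinduceFunctor (V := V) (TwoVect.Hom.functor L))
    (additive := inferInstanceAs (coinduceFunctor (V := V) (TwoVect.Hom.functor L)).Additive)
    (linear := inferInstanceAs ((coinduceFunctor (V := V) (TwoVect.Hom.functor L)).Linear k))
  naturality g := TwoVect.mkIso (coinduceIso (TwoVect.Hom.functor L) g)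
  -- Each coherence condition is `L` applied to an axiom of `V`: naturality of `tensorIso`, then the
  -- unit axiom, then associativity.
  naturality_naturality {_ _ g g'} η := TwoVect.hom₂_ext fun a => NatTrans.ext (funext fun x => by
    change (TwoVect.Hom.functor L).map ((V.act x).map ((V.actMap η).app a)) ≫
        (TwoVect.Hom.functor L).map (V.tensorIso x g' a).inv =
      (TwoVect.Hom.functor L).map (V.tensorIso x g a).inv ≫
        (TwoVect.Hom.functor L).map ((V.actMap (x ◁ η)).app a)
    rw [← Functor.map_comp, ← Functor.map_comp]
    congr 1
    rw [Iso.eq_inv_comp, ← reassoc_of% @TwoRep.actMap_whiskerLeft_tensor, Iso.hom_inv_id,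
      Category.comp_id])
  naturality_id _ := TwoVect.hom₂_ext fun a => NatTrans.ext (funext fun x => by
    change (TwoVect.Hom.functor L).map (V.tensorIso x (𝟙_ G) a).inv ≫
        (TwoVect.Hom.functor L).map ((V.actMap (ρ_ x).hom).app a) =
      (TwoVect.Hom.functor L).map ((V.act x).map (V.unitIso a).hom) ≫ 𝟙 _ ≫ 𝟙 _
    rw [Category.comp_id, Category.comp_id, ← Functor.map_comp, V.actMap_rightUnitor,
      Iso.inv_hom_id_assoc])
  naturality_comp f g := TwoVect.hom₂_ext fun a => NatTrans.ext (funext fun x => by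
    change (TwoVect.Hom.functor L).map (V.tensorIso x ((g : G) ⊗ (f : G)) a).inv ≫
        (TwoVect.Hom.functor L).map ((V.actMap (α_ x (g : G) (f : G)).inv).app a) =
      (TwoVect.Hom.functor L).map ((V.act x).map (V.tensorIso g f a).hom) ≫ 𝟙 _ ≫
        (TwoVect.Hom.functor L).map (V.tensorIso x g ((V.act f).obj a)).inv ≫ 𝟙 _ ≫
        (TwoVect.Hom.functor L).map (V.tensorIso (x ⊗ (g : G)) f a).inv ≫ 𝟙 _
    rw [Category.comp_id, Category.id_comp, Category.id_comp, V.actMap_associator_inv]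
    simp only [← Functor.map_comp, Iso.inv_hom_id_assoc])

/-- The isomorphism `L (𝟙 · a) ≅ L a`. -/
def coinduceUnitIso (L : V.Carrier ⥤ C.carrier) :
    coinduceFunctor L ⋙ (evaluation G C.carrier).obj (𝟙_ G) ≅ L :=
  NatIso.ofComponents (fun a => L.mapIso (V.unitIso a)) (fun {a b} t => by
    change L.map ((V.act (𝟙_ G)).map t) ≫ L.map (V.unitIso b).hom =
      L.map (V.unitIso a).hom ≫ L.map t
    rw [← L.map_comp, ← L.map_comp, V.unitIso_naturality])

instance essSurj_transpose : (transpose (forgetful k G) (evalOne G C) V).EssSurj where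
  mem_essImage L :=
    ⟨coinduce L, ⟨TwoVect.mkIso (coinduceUnitIso (V := V) (TwoVect.Hom.functor L))⟩⟩

/-- The category `Fun(G, C)` is the cofree 2-representation on `C`. -/
instance isEquivalence_transpose_evalOne :
    (transpose (forgetful k G) (evalOne G C) V).IsEquivalence where

end Universal

/-! ### Uniqueness of representing objects, a bicategorical Yoneda argument. -/

section Uniqueness

open Bicategory

universe w₁ v₁ u₁ w₂ v₂ u₂

variable {B : Type u₁} [Bicategory.{w₁, v₁} B] {C : Type u₂} [Bicategory.{w₂, v₂} C]
  (F : Pseudofunctor B C) {c : C}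

lemma exists_transpose_iso {x y : B} (e : F.obj x ⟶ c) (e' : F.obj y ⟶ c)
    [(transpose F e' x).EssSurj] : ∃ f : x ⟶ y, Nonempty (F.map f ≫ e' ≅ e) :=
  ⟨_, ⟨(transpose F e' x).objObjPreimageIso e⟩⟩

/-- `f` and `𝟙 x` have isomorphic transposes, and a fully faithful functor reflects isomorphisms
between objects. -/
lemma nonempty_iso_id_of_transpose {x : B} (e : F.obj x ⟶ c) [(transpose F e x).Full]
    [(transpose F e x).Faithful] (f : x ⟶ x) (i : F.map f ≫ e ≅ e) : Nonempty (f ≅ 𝟙 x) :=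
  ⟨(transpose F e x).preimageIso
    (show F.map f ≫ e ≅ F.map (𝟙 x) ≫ e from
      i ≪≫ (λ_ e).symm ≪≫ whiskerRightIso (F.mapId x).symm e)⟩

/-- Objects that represent the same 2-presheaf `b ↦ C(F b, c)` are equivalent. -/
lemma nonempty_equivalence_of_transpose {x y : B} (e : F.obj x ⟶ c) (e' : F.obj y ⟶ c)
    (h : ∀ b, (transpose F e b).IsEquivalence) (h' : ∀ b, (transpose F e' b).IsEquivalence) :
    Nonempty (Bicategory.Equivalence x y) := by
  have := h x
  have := h y
  have := h' x
  have := h' y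
  obtain ⟨f, ⟨i⟩⟩ := exists_transpose_iso F e e'
  obtain ⟨g, ⟨j⟩⟩ := exists_transpose_iso F e' e
  -- `F (f ≫ g) ≫ e ≅ F f ≫ (F g ≫ e) ≅ F f ≫ e' ≅ e`, and symmetrically for `g ≫ f`.
  obtain ⟨η⟩ := nonempty_iso_id_of_transpose F e (f ≫ g)
    (whiskerRightIso (F.mapComp f g) e ≪≫ α_ _ _ _ ≪≫ whiskerLeftIso (F.map f) j ≪≫ i)
  obtain ⟨κ⟩ := nonempty_iso_id_of_transpose F e' (g ≫ f)
    (whiskerRightIso (F.mapComp g f) e' ≪≫ α_ _ _ _ ≪≫ whiskerLeftIso (F.map g) i ≪≫ j)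
  -- The two isomorphisms need not satisfy the triangle identities; the counit is corrected so that
  -- they hold.
  exact ⟨Bicategory.Equivalence.mkOfAdjointifyCounit η.symm κ⟩

end Uniqueness

/-! ### Functoriality of the cofree construction and the adjunction. -/

section RightAdjoint

open MonoidalCategory

variable {k : Type u} [Field k] {G : Type u} [Category.{u} G] [MonoidalCategory G]
  [CharZero k] [IsFiniteGroupoid G] {C D E : TwoVect k}

instance (F : C.carrier ⥤ D.carrier) [F.Additive] :
    ((Functor.whiskeringRight G C.carrier D.carrier).obj F).Additive where
  map_add {_ _ f g} := by ext x; exact F.map_add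

instance (F : C.carrier ⥤ D.carrier) [F.Additive] [F.Linear k] :
    ((Functor.whiskeringRight G C.carrier D.carrier).obj F).Linear k where
  map_smul f r := by ext x; exact F.map_smul r (f.app x)

variable (G) in
/-- Composition with a linear functor, as a 1-morphism of `2Vect`. -/
def postcompose (F : C ⟶ D) : functorTwoVect G C ⟶ functorTwoVect G D :=
  TwoVect.Hom.mk ((Functor.whiskeringRight G C.carrier D.carrier).obj (TwoVect.Hom.functor F))

variable (G) in
/-- Composition with a linear functor, as a 1-morphism of cofree 2-representations. -/
def cofreeMap (F : C ⟶ D) : cofreeRep G C ⟶ cofreeRep G D where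
  app _ := postcompose G F
  -- Precomposition by `- ⊗ g` and postcomposition by `F` agree on objects, so this constraint has
  -- identity components and the coherences reduce to cancelling identities.
  naturality g := TwoVect.mkIso (NatIso.ofComponents
    (fun X => Functor.associator (tensorRight g) X (TwoVect.Hom.functor F)) (fun s =>
      NatTrans.ext (funext fun x => (Category.comp_id _).trans (Category.id_comp _).symm)))
  naturality_naturality η := TwoVect.hom₂_ext fun X => NatTrans.ext (funext fun x =>
    (Category.comp_id _).trans (Category.id_comp _).symm)
  naturality_id _ := TwoVect.hom₂_ext fun X => NatTrans.ext (funext fun x => by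
    change 𝟙 _ ≫ (TwoVect.Hom.functor F).map (X.map (ρ_ x).hom) =
      (TwoVect.Hom.functor F).map (X.map (ρ_ x).hom) ≫ 𝟙 _ ≫ 𝟙 _
    simp only [Category.id_comp, Category.comp_id])
  naturality_comp f g := TwoVect.hom₂_ext fun X => NatTrans.ext (funext fun x => by
    change 𝟙 _ ≫ (TwoVect.Hom.functor F).map (X.map (α_ x (g : G) (f : G)).inv) =
      (TwoVect.Hom.functor F).map (X.map (α_ x (g : G) (f : G)).inv) ≫ 𝟙 _ ≫ 𝟙 _ ≫ 𝟙 _ ≫ 𝟙 _ ≫ 𝟙 _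
    simp only [Category.id_comp, Category.comp_id])

variable (G) in
/-- The 2-morphism of cofree 2-representations induced by a natural transformation. -/
def cofreeMap₂ {F H : C ⟶ D} (α : F ⟶ H) : cofreeMap G F ⟶ cofreeMap G H :=
  Pseudofunctor.StrongTrans.Hom.of
    { app := fun _ => TwoVect.Hom₂.mk
        ((Functor.whiskeringRight G C.carrier D.carrier).map (TwoVect.Hom₂.nat α))
      naturality := fun _ => TwoVect.hom₂_ext fun _ => NatTrans.ext (funext fun _ =>
        (Category.comp_id _).trans (Category.id_comp _).symm) }

variable (G) in
/-- Composition with the identity functor. -/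
def postcomposeId (C : TwoVect k) : postcompose G (𝟙 C) ≅ 𝟙 (functorTwoVect G C) :=
  TwoVect.mkIso (NatIso.ofComponents (fun X => Functor.rightUnitor X) (fun s => by
    ext x
    exact (Category.comp_id _).trans (Category.id_comp _).symm))

variable (G) in
/-- Composition with a composite functor. -/
def postcomposeComp (F : C ⟶ D) (H : D ⟶ E) :
    postcompose G (F ≫ H) ≅ postcompose G F ≫ postcompose G H :=
  TwoVect.mkIso (NatIso.ofComponents
    (fun X => (Functor.associator X (TwoVect.Hom.functor F) (TwoVect.Hom.functor H)).symm)
    (fun s => by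
      ext x
      exact (Category.comp_id _).trans (Category.id_comp _).symm))

variable (G) in
/-- The unit constraint of the cofree pseudofunctor. -/
def cofreeMapId (C : TwoVect k) : cofreeMap G (𝟙 C) ≅ 𝟙 (cofreeRep G C) :=
  Pseudofunctor.StrongTrans.isoMk (fun _ => postcomposeId G C) fun g =>
    TwoVect.hom₂_ext fun X => NatTrans.ext (funext fun x => by
      change 𝟙 _ ≫ 𝟙 _ ≫ 𝟙 _ = 𝟙 _ ≫ 𝟙 (X.obj (x ⊗ (g : G)))
      simp only [Category.comp_id])

variable (G) in
/-- The composition constraint of the cofree pseudofunctor. -/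
def cofreeMapComp (F : C ⟶ D) (H : D ⟶ E) :
    cofreeMap G (F ≫ H) ≅ cofreeMap G F ≫ cofreeMap G H :=
  Pseudofunctor.StrongTrans.isoMk (fun _ => postcomposeComp G F H) fun g =>
    TwoVect.hom₂_ext fun X => NatTrans.ext (funext fun x => by
      change 𝟙 _ ≫ 𝟙 _ ≫ (TwoVect.Hom.functor H).map (𝟙 _) ≫ 𝟙 _ ≫ 𝟙 _ ≫ 𝟙 _ = 𝟙 _ ≫ 𝟙
        ((TwoVect.Hom.functor H).obj ((TwoVect.Hom.functor F).obj (X.obj (x ⊗ (g : G)))))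
      simp only [Category.comp_id, Category.id_comp]
      exact (TwoVect.Hom.functor H).map_id _)

lemma strongTrans_hom_ext {V : TwoRep k G} {φ ψ : V ⟶ cofreeRep G C} {Γ Δ : φ ⟶ ψ}
    (h : ∀ (a : V.Carrier) (x : G), ((EquivariantFunctor.toNatTrans Γ).app a).app x =
      ((EquivariantFunctor.toNatTrans Δ).app a).app x) : Γ = Δ :=
  Pseudofunctor.StrongTrans.homCategory.ext fun _ => TwoVect.hom₂_ext fun a =>
    NatTrans.ext (funext fun x => h a x)

variable (k G) in
/-- The pseudofunctor `C ↦ Fun(G, C)` from `2Vect` to 2-representations. -/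
def cofree : Pseudofunctor (TwoVect k) (TwoRep k G) where
  obj C := cofreeRep G C
  map F := cofreeMap G F
  map₂ α := cofreeMap₂ G α
  mapId C := cofreeMapId G C
  mapComp F H := cofreeMapComp G F H
  map₂_id F := strongTrans_hom_ext fun X x => rfl
  map₂_comp α β := strongTrans_hom_ext fun X x => rfl
  map₂_whisker_left {_ _ _} F {H H'} α := strongTrans_hom_ext fun X x => by
    change (TwoVect.Hom₂.nat α).app ((TwoVect.Hom.functor F).obj (X.obj x)) =
      𝟙 _ ≫ (TwoVect.Hom₂.nat α).app ((TwoVect.Hom.functor F).obj (X.obj x)) ≫ 𝟙 _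
    simp only [Category.comp_id, Category.id_comp]
  map₂_whisker_right {_ _ _} F H α K := strongTrans_hom_ext fun X x => by
    change (TwoVect.Hom.functor K).map ((TwoVect.Hom₂.nat α).app (X.obj x)) =
      𝟙 _ ≫ (TwoVect.Hom.functor K).map ((TwoVect.Hom₂.nat α).app (X.obj x)) ≫ 𝟙 _
    simp only [Category.comp_id, Category.id_comp]
  map₂_associator F H K := strongTrans_hom_ext fun X x => by
    change 𝟙 ((TwoVect.Hom.functor K).obj ((TwoVect.Hom.functor H).obj
        ((TwoVect.Hom.functor F).obj (X.obj x)))) =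
      𝟙 _ ≫ (TwoVect.Hom.functor K).map (𝟙 _) ≫ 𝟙 _ ≫ 𝟙 _ ≫ 𝟙 _
    simp only [Category.comp_id, Category.id_comp]
    exact ((TwoVect.Hom.functor K).map_id _).symm
  map₂_left_unitor F := strongTrans_hom_ext fun X x => by
    change 𝟙 ((TwoVect.Hom.functor F).obj (X.obj x)) =
      𝟙 _ ≫ (TwoVect.Hom.functor F).map (𝟙 _) ≫ 𝟙 _
    simp only [Category.comp_id, Category.id_comp]
    exact ((TwoVect.Hom.functor F).map_id _).symm
  map₂_right_unitor F := strongTrans_hom_ext fun X x => by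
    change 𝟙 ((TwoVect.Hom.functor F).obj (X.obj x)) = 𝟙 _ ≫ 𝟙 _ ≫ 𝟙 _
    simp only [Category.comp_id]

variable (k G) in
/-- Evaluation at the tensor unit is pseudonatural. -/
def cofreeCounit : (cofree k G).comp (forgetful k G) ⟶ Pseudofunctor.id (TwoVect k) where
  app C := evalOne G C
  -- Evaluating at `𝟙` after postcomposing with `F` is `F` of the evaluation, so the constraint is
  -- again an identity.
  naturality {C D} F := TwoVect.mkIso (F := postcompose G F ≫ evalOne G D) (G := evalOne G C ≫ F)
    (NatIso.ofComponents
      (fun X => Iso.refl ((TwoVect.Hom.functor F).obj (X.obj (𝟙_ G)))) fun s =>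
        (Category.comp_id _).trans (Category.id_comp _).symm)
  naturality_naturality α := TwoVect.hom₂_ext fun X =>
    (Category.comp_id _).trans (Category.id_comp _).symm
  naturality_id C := TwoVect.hom₂_ext fun X => by
    change 𝟙 _ ≫ 𝟙 _ = (𝟙 _ ≫ 𝟙 _) ≫ 𝟙 _ ≫ 𝟙 (X.obj (𝟙_ G))
    simp only [Category.comp_id]
  naturality_comp F H := TwoVect.hom₂_ext fun X => by
    change 𝟙 _ ≫ 𝟙 _ = (𝟙 _ ≫ 𝟙 _) ≫ 𝟙 _ ≫ 𝟙 _ ≫ 𝟙 _ ≫ (TwoVect.Hom.functor H).map (𝟙 _) ≫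
      𝟙 ((TwoVect.Hom.functor H).obj ((TwoVect.Hom.functor F).obj (X.obj (𝟙_ G))))
    simp only [Category.comp_id, Category.id_comp]
    exact ((TwoVect.Hom.functor H).map_id _).symm

variable (k G) in
/-- The cofree pseudofunctor is right adjoint to the forgetful one. -/
def cofreeRightAdjoint : RightAdjointOf (forgetful k G) where
  right := cofree k G
  counit := cofreeCounit k G
  isEquivalence V C := isEquivalence_transpose_evalOne (V := V) (C := C)

end RightAdjoint

end TwoRepTheory

theorem mainTheorem7 (k : Type u) [Field k] [IsAlgClosed k] [CharZero k]
    (G : Type u) [Category.{u} G] [MonoidalCategory G] [TwoRepTheory.IsFiniteTwoGroup G] :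
    ∃ h : TwoRepTheory.IsFiniteSemisimple k (G ⥤ FGModuleCat.{u} k),
      -- the forgetful 2-functor has a right adjoint
      Nonempty (TwoRepTheory.RightAdjointOf (TwoRepTheory.forgetful k G)) ∧
      -- every right adjoint sends `Vect` to the regular 2-representation, up to equivalence
      (∀ R : TwoRepTheory.RightAdjointOf (TwoRepTheory.forgetful k G),
        Nonempty (Bicategory.Equivalence (TwoRepTheory.regular k G h)
          (R.right.obj (TwoRepTheory.vect k)))) ∧
      -- equivariant functors into the regular 2-representation are linear functors into `Vect`
      ∀ V : TwoRepTheory.TwoRep k G,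
        (TwoRepTheory.transpose (TwoRepTheory.forgetful k G)
          (TwoRepTheory.evalUnit k G h) V).IsEquivalence := by
  obtain h : TwoRepTheory.IsFiniteSemisimple k (G ⥤ FGModuleCat.{u} k) :=
    TwoRepTheory.isFiniteSemisimple_functor G k (FGModuleCat.{u} k)
  -- `regular` and `evalUnit` unfold to `cofreeRep` and `evalOne` at `vect k`, so the universal
  -- property applies by definitional equality.
  have hreg (V : TwoRepTheory.TwoRep k G) :
      (TwoRepTheory.transpose (TwoRepTheory.forgetful k G)
        (TwoRepTheory.evalUnit k G h) V).IsEquivalence :=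
    TwoRepTheory.isEquivalence_transpose_evalOne (V := V) (C := TwoRepTheory.vect k)
  exact ⟨h, ⟨TwoRepTheory.cofreeRightAdjoint k G⟩,
    fun R => TwoRepTheory.nonempty_equivalence_of_transpose (TwoRepTheory.forgetful k G)
      (TwoRepTheory.evalUnit k G h) (R.counit.app (TwoRepTheory.vect k)) hreg
      fun V => R.isEquivalence V (TwoRepTheory.vect k), hreg⟩
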